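/- Let $A\in\mathbb{R}^{n\times n}$ be nonsingular, $B\in\mathbb{R}^{n\times m}$ with $(A,B)$ controllable, $Q\in\mathbb{R}^{n\times n}$ symmetric positive semidefinite and $R\in\mathbb{R}^{m\times m}$ symmetric positive definite. Call $K\in\mathbb{R}^{m\times n}$ a stabilizing derivative-feedback gain for $\dot x=Ax+Bu$ if, under $u=-K\dot x$, the closed loop $(I+BK)\dot x=Ax$ is such that $I+BK$ is invertible and $(I+BK)^{-1}A$ is Hurwitz (all eigenvalues have negative real part). Consider the algebraic Riccati equation $$P A^{-1}+A^{-T}P-PA^{-1}BR^{-1}B^{T}A^{-T}P+Q=0. \tag{ARE}$$ Let $K_1$ be any stabilizing derivative-feedback gain. If $(Q^{1/2},A)$ is observable, then (ARE) has a positive definite solution. Moreover, whenever (ARE) has a positive definite solution $P^*$, it is the only positive definite solution and, with $K^*=-R^{-1}B^{T}A^{-T}P^*$, the following holds. Starting from $K_1$, for $i=1,2,\dots$ the equation $$P_iA_i^{-1}+A_i^{-T}P_i+Q+K_i^{T}RK_i=0,\qquad A_i^{-1}:=A^{-1}(I+BK_i),$$ has a unique positive definite solution $P_i$, and one defines $$K_{i+1}=-R^{-1}B^{T}A^{-T}P_i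 .$$ For all $i\ge 1$: 1. $I+BK_{i+1}$ is invertible and $(I+BK_{i+1})^{-1}A$ is Hurwitz; 2. $P^*\le P_{i+1}\le P_i$ in the positive semidefinite order; 3. $\lim_{i\to\infty}P_i=P^*$ and $\lim_{i\to\infty}K_i=K^*$. -/

import Mathlib

open Matrix Filter Topology

noncomputable section

namespace DFC

variable {n m : ℕ}

/-- A real square matrix is Hurwitz if all its complex eigenvalues have negative real part. -/
def IsHurwitz (M : Matrix (Fin n) (Fin n) ℝ) : Prop :=
  ∀ μ ∈ spectrum ℂ (M.map (algebraMap ℝ ℂ)), μ.re < 0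

/-- The controllability matrix `[B, AB, …, Aⁿ⁻¹B]`; column `(k, j)` is column `j` of `Aᵏ B`. -/
def controllabilityMatrix (A : Matrix (Fin n) (Fin n) ℝ) (B : Matrix (Fin n) (Fin m) ℝ) :
    Matrix (Fin n) (Fin n × Fin m) ℝ :=
  Matrix.of fun i kj => (A ^ (kj.1 : ℕ) * B) i kj.2

/-- Controllability of `ẋ = A x + B u` (Kalman rank condition). -/
def IsControllable (A : Matrix (Fin n) (Fin n) ℝ) (B : Matrix (Fin n) (Fin m) ℝ) : Prop :=
  (controllabilityMatrix A B).rank = n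

/-- The observability matrix with block rows `C, CA, …, CAⁿ⁻¹`. -/
def observabilityMatrix (C A : Matrix (Fin n) (Fin n) ℝ) :
    Matrix (Fin n × Fin n) (Fin n) ℝ :=
  Matrix.of fun ki j => (C * A ^ (ki.1 : ℕ)) ki.2 j

/-- Observability of the pair `(C, A)` (Kalman rank condition). -/
def IsObservable (C A : Matrix (Fin n) (Fin n) ℝ) : Prop :=
  (observabilityMatrix C A).rank = n

/-- `K` is a stabilizing derivative-feedback gain: under `u = -K ẋ` the closed loop
`(I + B K) ẋ = A x` is a well-posed ODE, and its matrix `(I + B K)⁻¹ A` is Hurwitz. -/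
def IsStabilizing (A : Matrix (Fin n) (Fin n) ℝ) (B : Matrix (Fin n) (Fin m) ℝ)
    (K : Matrix (Fin m) (Fin n) ℝ) : Prop :=
  IsUnit (1 + B * K).det ∧ IsHurwitz ((1 + B * K)⁻¹ * A)

/-- `P` solves the algebraic Riccati equation of the derivative-feedback LQR problem. -/
def SolvesARE (A : Matrix (Fin n) (Fin n) ℝ) (B : Matrix (Fin n) (Fin m) ℝ)
    (Q : Matrix (Fin n) (Fin n) ℝ) (R : Matrix (Fin m) (Fin m) ℝ)
    (P : Matrix (Fin n) (Fin n) ℝ) : Prop :=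
  P * A⁻¹ + A⁻¹ᵀ * P - P * A⁻¹ * B * R⁻¹ * Bᵀ * A⁻¹ᵀ * P + Q = 0

/-- The gain `-R⁻¹ Bᵀ A⁻ᵀ P` belonging to `P`. -/
def gain (A : Matrix (Fin n) (Fin n) ℝ) (B : Matrix (Fin n) (Fin m) ℝ)
    (R : Matrix (Fin m) (Fin m) ℝ) (P : Matrix (Fin n) (Fin n) ℝ) :
    Matrix (Fin m) (Fin n) ℝ :=
  -(R⁻¹ * Bᵀ * A⁻¹ᵀ * P)

/-- The matrix `A⁻¹ (I + B K)`, the inverse of the closed-loop matrix. -/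
def closedLoopInv (A : Matrix (Fin n) (Fin n) ℝ) (B : Matrix (Fin n) (Fin m) ℝ)
    (K : Matrix (Fin m) (Fin n) ℝ) : Matrix (Fin n) (Fin n) ℝ :=
  A⁻¹ * (1 + B * K)

/-- `P` solves the policy-evaluation (Lyapunov) equation for the gain `K`. -/
def SolvesLyapunov (A : Matrix (Fin n) (Fin n) ℝ) (B : Matrix (Fin n) (Fin m) ℝ)
    (Q : Matrix (Fin n) (Fin n) ℝ) (R : Matrix (Fin m) (Fin m) ℝ)
    (K : Matrix (Fin m) (Fin n) ℝ) (P : Matrix (Fin n) (Fin n) ℝ) : Prop :=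
  P * closedLoopInv A B K + (closedLoopInv A B K)ᵀ * P + Q + Kᵀ * R * K = 0

/-- `(P i, K i)`, `i = 1, 2, …`, is a run of policy iteration started from the gain `K₁`.
The entries at index `0` play no role. -/
structure IsPolicyIteration (A : Matrix (Fin n) (Fin n) ℝ) (B : Matrix (Fin n) (Fin m) ℝ)
    (Q : Matrix (Fin n) (Fin n) ℝ) (R : Matrix (Fin m) (Fin m) ℝ)
    (K₁ : Matrix (Fin m) (Fin n) ℝ)
    (P : ℕ → Matrix (Fin n) (Fin n) ℝ) (K : ℕ → Matrix (Fin m) (Fin n) ℝ) : Prop where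
  init : K 1 = K₁
  posDef : ∀ i, 1 ≤ i → (P i).PosDef
  evaluation : ∀ i, 1 ≤ i → SolvesLyapunov A B Q R (K i) (P i)
  improvement : ∀ i, 1 ≤ i → K (i + 1) = gain A B R (P i)

end DFC

end

/-!
Put `F = A⁻¹` and `G = A⁻¹ B`. Since a matrix is Hurwitz exactly when its inverse is, derivative
feedback `u = -K ẋ` stabilizes `ẋ = A x + B u` iff `F + G K = A⁻¹ (1 + B K)` is Hurwitz, that
is, iff the state feedback `u = K x` stabilizes `ẋ = F x + G u`. The policy iteration is
therefore Kleinman's iteration for the pair `(F, G)`.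

If `M` is Hurwitz, `P M + Mᵀ P ≤ 0` forces `0 ≤ P`: the Cayley transform `c` of `M` satisfies
`c* P c ≤ P`, and its powers tend to `0`. So the cost matrix of a stabilizing gain is antitone
in the residual of its Lyapunov equation. Completing the square in `K` then gives both the
monotonicity of the iteration and the lower bound by solutions of the Riccati equation, so the
iteration converges, and by continuity its limit solves the Riccati equation.

That the closed loops stay Hurwitz rests on a single detectability argument: if
`P M + Mᵀ P + Cᵀ R C ≤ 0` with `0 ≤ P`, an eigenvector of `M` for an eigenvalue in the closed
right half-plane is killed by `C`, hence is an eigenvector of every `M + H C`, which is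
impossible if some `M + H C` is Hurwitz. If `(S, A)` is observable and `Q = Sᵀ S`, a positive
semidefinite solution of the Riccati equation is definite, because its kernel is
`A⁻¹`-invariant, hence `A`-invariant, and lies in the kernel of `S`.
-/

namespace DFC

open scoped MatrixOrder ComplexOrder

section BanachAlgebra

variable {𝒜 : Type*} [NormedRing 𝒜] [NormedAlgebra ℂ 𝒜] [CompleteSpace 𝒜]

lemma tendsto_pow_nhds_zero_of_spectralRadius_lt_one {c : 𝒜} (hc : spectralRadius ℂ c < 1) :
    Tendsto (fun k : ℕ => c ^ k) atTop (𝓝 0) := by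
  obtain ⟨r, hcr, hr⟩ := ENNReal.lt_iff_exists_nnreal_btwn.1 hc
  have hr_pow : Tendsto (fun k : ℕ => (r : ℝ) ^ k) atTop (𝓝 0) :=
    tendsto_pow_atTop_nhds_zero_of_lt_one r.2 (by exact_mod_cast hr)
  refine squeeze_zero_norm' ?_ hr_pow
  have hroot := spectrum.pow_nnnorm_pow_one_div_tendsto_nhds_spectralRadius c
  filter_upwards [hroot.eventually_lt_const hcr, eventually_gt_atTop 0] with k hk hk0
  rw [one_div, ENNReal.rpow_inv_lt_iff (by exact_mod_cast hk0), ENNReal.rpow_natCast] at hk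
  exact_mod_cast hk.le

lemma tendsto_pow_nhds_zero_of_forall_spectrum_norm_lt_one {c : 𝒜}
    (hc : ∀ z ∈ spectrum ℂ c, ‖z‖ < 1) : Tendsto (fun k : ℕ => c ^ k) atTop (𝓝 0) := by
  nontriviality 𝒜
  exact tendsto_pow_nhds_zero_of_spectralRadius_lt_one
    (spectrum.spectralRadius_lt_of_forall_lt c (r := 1) hc)

end BanachAlgebra

section Cayley

variable {𝒜 : Type*} [Ring 𝒜]

/-- The Cayley transform `(1 + a)(1 - a)⁻¹`, which turns a stable continuous-time system into a
stable discrete-time one. Since `Ring.inverse` is used, it is junk if `1 - a` is not a unit. -/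
noncomputable def cayley (a : 𝒜) : 𝒜 :=
  (1 + a) * Ring.inverse (1 - a)

lemma sub_cayley_conjugate [StarRing 𝒜] {a : 𝒜} (ha : IsUnit (1 - a)) (p : 𝒜) :
    p - star (cayley a) * p * cayley a =
      2 • (star (Ring.inverse (1 - a)) * -(p * a + star a * p) * Ring.inverse (1 - a)) := by
  set b := Ring.inverse (1 - a) with hb
  have hab : (1 - a) * b = 1 := Ring.mul_inverse_cancel _ ha
  have hba : star b * (1 - star a) = 1 := by simpa using congrArg star hab
  calc p - star (cayley a) * p * cayley a
      = star b * (1 - star a) * p * ((1 - a) * b) - star (cayley a) * p * cayley a := by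
        rw [hab, hba, one_mul, mul_one]
    _ = 2 • (star b * -(p * a + star a * p) * b) := by
        rw [cayley, ← hb, star_mul, star_add, star_one]
        noncomm_ring

/-- An element of a complex algebra is spectrally stable if its spectrum lies in the open left
half-plane; a real matrix is Hurwitz iff its complexification is spectrally stable. -/
def IsSpectrallyStable [Algebra ℂ 𝒜] (a : 𝒜) : Prop :=
  ∀ z ∈ spectrum ℂ a, z.re < 0

lemma norm_lt_one_of_one_add_mul_eq {z w : ℂ} (h : (1 + z) * w = z - 1) (hw : w.re < 0) :
    ‖z‖ < 1 := by
  have hdist : ‖1 + w‖ < ‖1 - w‖ := by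
    refine lt_of_pow_lt_pow_left₀ 2 (norm_nonneg _) ?_
    simp only [Complex.sq_norm, Complex.normSq_apply, Complex.add_re, Complex.add_im,
      Complex.sub_re, Complex.sub_im, Complex.one_re, Complex.one_im]
    linarith
  have hz : ‖z‖ * ‖1 - w‖ = ‖1 + w‖ := by
    rw [← norm_mul]
    congr 1
    linear_combination -h
  nlinarith [norm_nonneg (1 - w)]

variable [Algebra ℂ 𝒜] {a : 𝒜}

lemma IsSpectrallyStable.isUnit_sub (ha : IsSpectrallyStable a) {z : ℂ} (hz : 0 ≤ z.re) :
    IsUnit (algebraMap ℂ 𝒜 z - a) :=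
  spectrum.notMem_iff.1 fun h => (ha z h).not_ge hz

lemma IsSpectrallyStable.isUnit_one_sub (ha : IsSpectrallyStable a) : IsUnit (1 - a) := by
  simpa using ha.isUnit_sub (z := 1) zero_le_one

lemma IsSpectrallyStable.norm_lt_one_of_mem_spectrum_cayley (ha : IsSpectrallyStable a) {z : ℂ}
    (hz : z ∈ spectrum ℂ (cayley a)) : ‖z‖ < 1 := by
  have hu := ha.isUnit_one_sub
  have hfactor : algebraMap ℂ 𝒜 z - cayley a =
      (algebraMap ℂ 𝒜 (z - 1) - algebraMap ℂ 𝒜 (1 + z) * a) * Ring.inverse (1 - a) := by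
    calc algebraMap ℂ 𝒜 z - cayley a
        = algebraMap ℂ 𝒜 z * ((1 - a) * Ring.inverse (1 - a)) - cayley a := by
          rw [Ring.mul_inverse_cancel _ hu, mul_one]
      _ = _ := by
          simp only [cayley, map_sub, map_add, map_one]
          noncomm_ring
  have hnot : ¬ IsUnit (algebraMap ℂ 𝒜 (z - 1) - algebraMap ℂ 𝒜 (1 + z) * a) := fun h =>
    spectrum.mem_iff.1 hz (hfactor ▸ h.mul hu.ringInverse)
  rcases eq_or_ne (1 + z) 0 with h0 | h0
  · have hz2 : z - 1 = -2 := by linear_combination h0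
    rw [h0, hz2, map_zero, zero_mul, sub_zero] at hnot
    exact absurd ((isUnit_iff_ne_zero.2 (by norm_num)).map (algebraMap ℂ 𝒜)) hnot
  · have hw : (1 + z) * ((z - 1) / (1 + z)) = z - 1 := mul_div_cancel₀ _ h0
    refine norm_lt_one_of_one_add_mul_eq hw (ha _ fun h => hnot ?_)
    rw [← hw, map_mul, ← mul_sub]
    exact ((isUnit_iff_ne_zero.2 h0).map (algebraMap ℂ 𝒜)).mul h

lemma IsSpectrallyStable.units_inv {u : 𝒜ˣ} (hu : IsSpectrallyStable (u : 𝒜)) :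
    IsSpectrallyStable (↑u⁻¹ : 𝒜) := by
  intro z hz
  have hre : z.re / Complex.normSq z < 0 := by
    simpa only [Complex.inv_re] using hu _ (spectrum.inv₀_mem_iff.2 hz)
  exact lt_of_not_ge fun h => hre.not_ge (div_nonneg h (Complex.normSq_nonneg z))

end Cayley

section Lyapunov

variable {𝒜 : Type*} [CStarAlgebra 𝒜] [PartialOrder 𝒜] [StarOrderedRing 𝒜] {a p : 𝒜}

lemma pow_conjugate_le {c : 𝒜} (h : star c * p * c ≤ p) (k : ℕ) :
    star (c ^ k) * p * c ^ k ≤ p := by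
  induction k with
  | zero => simp
  | succ k ih =>
    calc star (c ^ (k + 1)) * p * c ^ (k + 1)
        = star (c ^ k) * (star c * p * c) * c ^ k := by
          rw [pow_succ', star_mul]
          noncomm_ring
      _ ≤ star (c ^ k) * p * c ^ k := star_left_conjugate_le_conjugate h _
      _ ≤ p := ih

lemma IsSpectrallyStable.nonneg_of_lyapunov (ha : IsSpectrallyStable a)
    (h : p * a + star a * p ≤ 0) : 0 ≤ p := by
  have hstep : star (cayley a) * p * cayley a ≤ p := by
    rw [← sub_nonneg, sub_cayley_conjugate ha.isUnit_one_sub]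
    exact nsmul_nonneg (star_left_conjugate_nonneg (neg_nonneg.2 h) _) 2
  have hpow : Tendsto (fun k : ℕ => cayley a ^ k) atTop (𝓝 0) :=
    tendsto_pow_nhds_zero_of_forall_spectrum_norm_lt_one fun z hz =>
      ha.norm_lt_one_of_mem_spectrum_cayley hz
  have hlim : Tendsto (fun k : ℕ => star (cayley a ^ k) * p * cayley a ^ k) atTop (𝓝 0) := by
    simpa using (hpow.star.mul_const p).mul hpow
  exact le_of_tendsto' hlim (pow_conjugate_le hstep)

end Lyapunov

section Complexification

variable {ι : Type*}

lemma posSemidef_map_algebraMap_iff [Finite ι] {M : Matrix ι ι ℝ} :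
    (M.map (algebraMap ℝ ℂ)).PosSemidef ↔ M.PosSemidef := by
  classical
  have := Fintype.ofFinite ι
  refine ⟨fun h => .of_dotProduct_mulVec_nonneg ?_ fun x => ?_, fun h => ?_⟩
  · ext i j
    simpa using h.isHermitian.apply i j
  · have hcast : star (fun i => (x i : ℂ)) ⬝ᵥ M.map (algebraMap ℝ ℂ) *ᵥ (fun i => (x i : ℂ)) =
        ((star x ⬝ᵥ M *ᵥ x : ℝ) : ℂ) := by
      simp [dotProduct, mulVec]
    have hx := h.dotProduct_mulVec_nonneg fun i => (x i : ℂ)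
    rw [hcast] at hx
    exact_mod_cast hx
  · obtain ⟨D, rfl⟩ := CStarAlgebra.nonneg_iff_eq_star_mul_self.1 h.nonneg
    rw [star_eq_conjTranspose, Matrix.map_mul, conjTranspose_map _ fun x => by simp]
    exact posSemidef_conjTranspose_mul_self _

lemma posDef_map_algebraMap [Finite ι] {M : Matrix ι ι ℝ} (hM : M.PosDef) :
    (M.map (algebraMap ℝ ℂ)).PosDef := by
  classical
  have := Fintype.ofFinite ι
  rw [(posSemidef_map_algebraMap_iff.2 hM.posSemidef).posDef_iff_isUnit]
  exact hM.isUnit.map (algebraMap ℝ ℂ).mapMatrix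

lemma exists_mulVec_eq_smul_of_mem_spectrum [Fintype ι] [DecidableEq ι] {M : Matrix ι ι ℂ} {z : ℂ}
    (hz : z ∈ spectrum ℂ M) : ∃ v ≠ 0, M *ᵥ v = z • v := by
  rw [← spectrum_toLin', ← Module.End.hasEigenvalue_iff_mem_spectrum] at hz
  obtain ⟨v, hv⟩ := hz.exists_hasEigenvector
  exact ⟨v, hv.2, by simpa using hv.apply_eq_smul⟩

lemma mem_spectrum_of_mulVec_eq_smul [Fintype ι] [DecidableEq ι] {M : Matrix ι ι ℂ} {z : ℂ}
    {v : ι → ℂ} (hv : v ≠ 0) (h : M *ᵥ v = z • v) : z ∈ spectrum ℂ M := by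
  rw [← spectrum_toLin', ← Module.End.hasEigenvalue_iff_mem_spectrum]
  exact Module.End.hasEigenvalue_of_hasEigenvector ⟨by simpa using h, hv⟩

end Complexification

section Detectability

variable {ι κ : Type*} [Fintype ι] [Fintype κ]

lemma star_dotProduct_lyapunov_mulVec {P M : Matrix ι ι ℂ} {v : ι → ℂ} {z : ℂ}
    (hv : M *ᵥ v = z • v) :
    star v ⬝ᵥ (P * M + Mᴴ * P) *ᵥ v = (2 * z.re : ℝ) * (star v ⬝ᵥ P *ᵥ v) := by
  have hstar : star v ⬝ᵥ (Mᴴ * P) *ᵥ v = star z * (star v ⬝ᵥ P *ᵥ v) := by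
    rw [← mulVec_mulVec, dotProduct_mulVec, ← star_mulVec, hv, star_smul, smul_dotProduct,
      smul_eq_mul]
  rw [add_mulVec, dotProduct_add, hstar, ← mulVec_mulVec, hv, mulVec_smul, dotProduct_smul,
    smul_eq_mul, ← add_mul, ← Complex.add_conj, starRingEnd_apply]

lemma mulVec_eq_zero_of_lyapunov {P M : Matrix ι ι ℂ} {C : Matrix κ ι ℂ} {R : Matrix κ κ ℂ}
    {v : ι → ℂ} {z : ℂ} (hP : 0 ≤ P) (hR : R.PosDef) (h : P * M + Mᴴ * P + Cᴴ * R * C ≤ 0)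
    (hv : M *ᵥ v = z • v) (hz : 0 ≤ z.re) : C *ᵥ v = 0 := by
  have hform : (star v ⬝ᵥ (P * M + Mᴴ * P) *ᵥ v) + star (C *ᵥ v) ⬝ᵥ R *ᵥ (C *ᵥ v) ≤ 0 := by
    have := (nonneg_iff_posSemidef.1 (neg_nonneg.2 h)).dotProduct_mulVec_nonneg v
    rw [neg_mulVec, dotProduct_neg, neg_nonneg, add_mulVec _ (Cᴴ * R * C), dotProduct_add] at this
    simpa [star_mulVec, dotProduct_mulVec, vecMul_vecMul, Matrix.mul_assoc] using this
  by_contra hC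
  have hpos := hR.dotProduct_mulVec_pos hC
  rw [star_dotProduct_lyapunov_mulVec hv] at hform
  have hnonneg : 0 ≤ ((2 * z.re : ℝ) : ℂ) * (star v ⬝ᵥ P *ᵥ v) :=
    mul_nonneg (by exact_mod_cast mul_nonneg zero_le_two hz)
      ((nonneg_iff_posSemidef.1 hP).dotProduct_mulVec_nonneg v)
  exact (add_pos_of_nonneg_of_pos hnonneg hpos).not_ge hform

lemma isSpectrallyStable_of_lyapunov_of_detectable [DecidableEq ι] {P M : Matrix ι ι ℂ}
    {C : Matrix κ ι ℂ} {R : Matrix κ κ ℂ} {H : Matrix ι κ ℂ} (hP : 0 ≤ P) (hR : R.PosDef)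
    (h : P * M + Mᴴ * P + Cᴴ * R * C ≤ 0) (hH : IsSpectrallyStable (M + H * C)) :
    IsSpectrallyStable M := by
  intro z hz
  by_contra hre
  obtain ⟨v, hv0, hv⟩ := exists_mulVec_eq_smul_of_mem_spectrum hz
  have hC : C *ᵥ v = 0 := mulVec_eq_zero_of_lyapunov hP hR h hv (not_lt.1 hre)
  refine hre (hH z (mem_spectrum_of_mulVec_eq_smul hv0 ?_))
  rw [add_mulVec, ← mulVec_mulVec, hC, mulVec_zero, add_zero, hv]

end Detectability

section Hurwitz

variable {n : ℕ} {M P P' X : Matrix (Fin n) (Fin n) ℝ}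

lemma map_algebraMap_nonpos (hX : X ≤ 0) : X.map (algebraMap ℝ ℂ) ≤ 0 := by
  rw [← neg_nonneg, nonneg_iff_posSemidef] at hX ⊢
  rw [← posSemidef_map_algebraMap_iff] at hX
  exact (Matrix.map_neg _ (map_neg (algebraMap ℝ ℂ)) X) ▸ hX

lemma map_algebraMap_transpose {ι κ : Type*} (N : Matrix ι κ ℝ) :
    Nᵀ.map (algebraMap ℝ ℂ) = (N.map (algebraMap ℝ ℂ))ᴴ := by
  ext i j
  simp

open scoped Matrix.Norms.L2Operator in
lemma IsHurwitz.nonneg_of_lyapunov (hM : IsHurwitz M) (h : P * M + Mᵀ * P ≤ 0) : 0 ≤ P := by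
  have hℂ := map_algebraMap_nonpos h
  rw [Matrix.map_add _ (map_add _), Matrix.map_mul, Matrix.map_mul, map_algebraMap_transpose] at hℂ
  exact nonneg_iff_posSemidef.2 (posSemidef_map_algebraMap_iff.1
    (nonneg_iff_posSemidef.1 (IsSpectrallyStable.nonneg_of_lyapunov hM hℂ)))

lemma IsHurwitz.le_of_lyapunov_le (hM : IsHurwitz M)
    (h : P' * M + Mᵀ * P' ≤ P * M + Mᵀ * P) : P ≤ P' := by
  rw [← sub_nonneg]
  refine hM.nonneg_of_lyapunov ?_
  rw [← sub_nonpos] at h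
  convert h using 1
  noncomm_ring

lemma IsHurwitz.eq_of_lyapunov_eq (hM : IsHurwitz M)
    (h : P * M + Mᵀ * P = P' * M + Mᵀ * P') : P = P' :=
  le_antisymm (hM.le_of_lyapunov_le h.ge) (hM.le_of_lyapunov_le h.le)

lemma IsHurwitz.exists_lyapunov_eq (hM : IsHurwitz M) (X : Matrix (Fin n) (Fin n) ℝ) :
    ∃ P, P * M + Mᵀ * P = X := by
  let L := LinearMap.mulRight ℝ M + LinearMap.mulLeft ℝ Mᵀ
  have hinj : Function.Injective L := fun P P' h => hM.eq_of_lyapunov_eq h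
  exact LinearMap.injective_iff_surjective.1 hinj X

lemma isHurwitz_of_lyapunov_of_detectable {κ : Type*} [Fintype κ] {C : Matrix κ (Fin n) ℝ}
    {R : Matrix κ κ ℝ} {H : Matrix (Fin n) κ ℝ} (hP : 0 ≤ P) (hR : R.PosDef)
    (h : P * M + Mᵀ * P + Cᵀ * R * C ≤ 0) (hH : IsHurwitz (M + H * C)) : IsHurwitz M := by
  have hℂ := map_algebraMap_nonpos h
  simp only [Matrix.map_add _ (map_add _), Matrix.map_mul, map_algebraMap_transpose] at hℂ
  refine isSpectrallyStable_of_lyapunov_of_detectable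
    (nonneg_iff_posSemidef.2 (posSemidef_map_algebraMap_iff.2 (nonneg_iff_posSemidef.1 hP)))
    (posDef_map_algebraMap hR) hℂ (H := H.map (algebraMap ℝ ℂ)) ?_
  rwa [← Matrix.map_mul, ← Matrix.map_add _ (map_add _)]

lemma IsHurwitz.isUnit_det (hM : IsHurwitz M) : IsUnit M.det := by
  rw [isUnit_iff_ne_zero]
  intro h0
  have hu : IsUnit (M.map (algebraMap ℝ ℂ)) := by
    simpa using IsSpectrallyStable.isUnit_sub hM (z := 0) le_rfl
  have : (algebraMap ℝ ℂ) M.det ≠ 0 := by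
    rw [RingHom.map_det]
    exact ((isUnit_iff_isUnit_det _).1 hu).ne_zero
  simp [h0] at this

lemma IsHurwitz.transpose (hM : IsHurwitz M) : IsHurwitz Mᵀ := by
  intro z hz
  refine hM z fun h => hz ?_
  rw [spectrum.mem_resolventSet_iff, ← isUnit_transpose] at h
  rwa [transpose_sub, algebraMap_eq_diagonal, diagonal_transpose, ← transpose_map] at h

lemma IsHurwitz.of_transpose (hM : IsHurwitz Mᵀ) : IsHurwitz M := by
  simpa using hM.transpose

lemma IsHurwitz.inv (hM : IsHurwitz M) : IsHurwitz M⁻¹ := by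
  let u : (Matrix (Fin n) (Fin n) ℂ)ˣ :=
    Units.map (algebraMap ℝ ℂ).mapMatrix.toMonoidHom (nonsingInvUnit M hM.isUnit_det)
  have hu : IsSpectrallyStable (u : Matrix (Fin n) (Fin n) ℂ) := hM
  exact hu.units_inv

variable {m : ℕ} {A : Matrix (Fin n) (Fin n) ℝ} {B : Matrix (Fin n) (Fin m) ℝ}
  {K : Matrix (Fin m) (Fin n) ℝ}

lemma IsStabilizing.isUnit_det (hK : IsStabilizing A B K) : IsUnit A.det := by
  have h := hK.2.isUnit_det
  rw [det_mul] at h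
  exact isUnit_of_mul_isUnit_right h

lemma isStabilizing_iff : IsStabilizing A B K ↔ IsHurwitz (closedLoopInv A B K) := by
  refine ⟨fun hK => ?_, fun h => ?_⟩
  · have h := hK.2.inv
    rwa [Matrix.mul_inv_rev, nonsing_inv_nonsing_inv _ hK.1] at h
  · have hdet := h.isUnit_det
    rw [closedLoopInv, det_mul] at hdet
    refine ⟨isUnit_of_mul_isUnit_right hdet, ?_⟩
    have hA := (isUnit_nonsing_inv_det_iff).1 (isUnit_of_mul_isUnit_left hdet)
    simpa [closedLoopInv, Matrix.mul_inv_rev, nonsing_inv_nonsing_inv _ hA] using h.inv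

end Hurwitz

section LoewnerOrder

variable {ι κ : Type*} {M N : Matrix ι ι ℝ}

lemma transpose_eq_of_nonneg (hM : 0 ≤ M) : Mᵀ = M := by
  simpa using (nonneg_iff_posSemidef.1 hM).isHermitian.eq

lemma transpose_mul_mul_nonneg [Fintype ι] [Finite κ] (hM : 0 ≤ M) (C : Matrix ι κ ℝ) :
    0 ≤ Cᵀ * M * C := by
  have := Fintype.ofFinite κ
  simpa using ((nonneg_iff_posSemidef.1 hM).conjTranspose_mul_mul_same C).nonneg

lemma posDef_of_le (hM : M.PosDef) (h : M ≤ N) : N.PosDef := by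
  simpa using hM.add_posSemidef (le_iff.1 h)

end LoewnerOrder

section PolicyEvaluation

variable {n : ℕ} {κ : Type*} [Fintype κ]

/-- The residual of the policy-evaluation (Lyapunov) equation for state feedback `u = K x` on
`ẋ = F x + G u` with cost `∫ xᵀQx + uᵀRu`; the cost matrix of `K` is the `P` where it vanishes. -/
def lyapunovResidual (F : Matrix (Fin n) (Fin n) ℝ) (G : Matrix (Fin n) κ ℝ)
    (Q : Matrix (Fin n) (Fin n) ℝ) (R : Matrix κ κ ℝ) (K : Matrix κ (Fin n) ℝ)
    (P : Matrix (Fin n) (Fin n) ℝ) : Matrix (Fin n) (Fin n) ℝ :=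
  P * (F + G * K) + (F + G * K)ᵀ * P + Q + Kᵀ * R * K

variable {F Q P P' : Matrix (Fin n) (Fin n) ℝ} {G : Matrix (Fin n) κ ℝ} {R : Matrix κ κ ℝ}
  {K : Matrix κ (Fin n) ℝ}

lemma le_of_lyapunovResidual_le (hK : IsHurwitz (F + G * K))
    (h : lyapunovResidual F G Q R K P' ≤ lyapunovResidual F G Q R K P) : P ≤ P' :=
  hK.le_of_lyapunov_le (by simpa only [lyapunovResidual, add_le_add_iff_right] using h)

lemma eq_of_lyapunovResidual_eq (hK : IsHurwitz (F + G * K))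
    (h : lyapunovResidual F G Q R K P = lyapunovResidual F G Q R K P') : P = P' :=
  le_antisymm (le_of_lyapunovResidual_le hK h.ge) (le_of_lyapunovResidual_le hK h.le)

lemma exists_lyapunovResidual_eq_zero (hK : IsHurwitz (F + G * K)) :
    ∃ P, lyapunovResidual F G Q R K P = 0 := by
  obtain ⟨P, hP⟩ := hK.exists_lyapunov_eq (-(Q + Kᵀ * R * K))
  exact ⟨P, by rw [lyapunovResidual, hP]; abel⟩

lemma nonneg_of_lyapunovResidual_eq_zero (hQ : 0 ≤ Q) (hR : R.PosDef)
    (hK : IsHurwitz (F + G * K)) (h : lyapunovResidual F G Q R K P = 0) : 0 ≤ P := by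
  refine le_of_lyapunovResidual_le hK (Q := Q) (R := R) ?_
  rw [h, lyapunovResidual, Matrix.zero_mul, Matrix.mul_zero, zero_add, zero_add]
  exact add_nonneg hQ (transpose_mul_mul_nonneg hR.posSemidef.nonneg K)

lemma continuous_lyapunovResidual :
    Continuous fun x : Matrix κ (Fin n) ℝ × Matrix (Fin n) (Fin n) ℝ =>
      lyapunovResidual F G Q R x.1 x.2 := by
  unfold lyapunovResidual
  fun_prop

end PolicyEvaluation

section Riccati

variable {n : ℕ} {κ : Type*} [Fintype κ] [DecidableEq κ]

/-- The residual of the algebraic Riccati equation of the linear-quadratic regulator problem for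
`ẋ = F x + G u` with cost `∫ xᵀQx + uᵀRu`. -/
noncomputable def riccatiResidual (F : Matrix (Fin n) (Fin n) ℝ) (G : Matrix (Fin n) κ ℝ)
    (Q : Matrix (Fin n) (Fin n) ℝ) (R : Matrix κ κ ℝ) (P : Matrix (Fin n) (Fin n) ℝ) :
    Matrix (Fin n) (Fin n) ℝ :=
  P * F + Fᵀ * P - P * G * R⁻¹ * Gᵀ * P + Q

/-- The feedback gain, for `u = K x`, that is greedy with respect to the cost matrix `P`. -/
noncomputable def riccatiGain (G : Matrix (Fin n) κ ℝ) (R : Matrix κ κ ℝ)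
    (P : Matrix (Fin n) (Fin n) ℝ) : Matrix κ (Fin n) ℝ :=
  -(R⁻¹ * Gᵀ * P)

variable {F Q P P' : Matrix (Fin n) (Fin n) ℝ} {G : Matrix (Fin n) κ ℝ} {R : Matrix κ κ ℝ}
  {K : Matrix κ (Fin n) ℝ}

lemma lyapunovResidual_eq_riccatiResidual_add (hR : R.PosDef) (hP : 0 ≤ P) :
    lyapunovResidual F G Q R K P = riccatiResidual F G Q R P +
      (K - riccatiGain G R P)ᵀ * R * (K - riccatiGain G R P) := by
  have hR_unit : IsUnit R.det := (isUnit_iff_isUnit_det R).1 hR.isUnit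
  have hR_symm : R⁻¹ᵀ = R⁻¹ := transpose_eq_of_nonneg hR.inv.posSemidef.nonneg
  simp only [lyapunovResidual, riccatiResidual, riccatiGain, sub_neg_eq_add, transpose_add,
    transpose_mul, transpose_transpose, hR_symm, transpose_eq_of_nonneg hP, Matrix.mul_add,
    Matrix.add_mul, Matrix.mul_assoc, Matrix.nonsing_inv_mul_cancel_left _ _ hR_unit,
    Matrix.mul_nonsing_inv_cancel_left _ _ hR_unit]
  abel

lemma lyapunovResidual_riccatiGain (hR : R.PosDef) (hP : 0 ≤ P) :
    lyapunovResidual F G Q R (riccatiGain G R P) P = riccatiResidual F G Q R P := by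
  rw [lyapunovResidual_eq_riccatiResidual_add hR hP, sub_self, Matrix.mul_zero, add_zero]

lemma riccatiResidual_le_lyapunovResidual (hR : R.PosDef) (hP : 0 ≤ P) :
    riccatiResidual F G Q R P ≤ lyapunovResidual F G Q R K P := by
  rw [lyapunovResidual_eq_riccatiResidual_add hR hP]
  exact le_add_of_nonneg_right (transpose_mul_mul_nonneg hR.posSemidef.nonneg _)

lemma le_of_riccatiResidual_nonneg (hR : R.PosDef) (hK : IsHurwitz (F + G * K))
    (hP : lyapunovResidual F G Q R K P = 0) (hP'_nonneg : 0 ≤ P')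
    (hP' : 0 ≤ riccatiResidual F G Q R P') : P' ≤ P :=
  le_of_lyapunovResidual_le hK
    (hP.trans_le (hP'.trans (riccatiResidual_le_lyapunovResidual hR hP'_nonneg)))

lemma le_of_policy_improvement (hR : R.PosDef) (hP_nonneg : 0 ≤ P)
    (hK : IsHurwitz (F + G * riccatiGain G R P)) (hP : lyapunovResidual F G Q R K P = 0)
    (hP' : lyapunovResidual F G Q R (riccatiGain G R P) P' = 0) : P' ≤ P := by
  refine le_of_lyapunovResidual_le hK ?_ (Q := Q) (R := R)
  rw [hP', lyapunovResidual_riccatiGain hR hP_nonneg, ← hP]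
  exact riccatiResidual_le_lyapunovResidual hR hP_nonneg

lemma isHurwitz_add_mul_riccatiGain_of_lyapunovResidual_eq_zero (hQ : 0 ≤ Q) (hR : R.PosDef)
    (hK : IsHurwitz (F + G * K)) (hP : lyapunovResidual F G Q R K P = 0) :
    IsHurwitz (F + G * riccatiGain G R P) := by
  have hP_nonneg := nonneg_of_lyapunovResidual_eq_zero hQ hR hK hP
  set L := riccatiGain G R P with hL
  refine isHurwitz_of_lyapunov_of_detectable (C := K - L) (H := G) hP_nonneg hR ?_ ?_
  · have hsum : P * (F + G * L) + (F + G * L)ᵀ * P + (K - L)ᵀ * R * (K - L) =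
        -(Q + Lᵀ * R * L) := by
      rw [lyapunovResidual_eq_riccatiResidual_add hR hP_nonneg,
        ← lyapunovResidual_riccatiGain hR hP_nonneg, ← hL, lyapunovResidual] at hP
      rw [← sub_eq_zero, ← hP]
      abel
    rw [hsum, neg_nonpos]
    exact add_nonneg hQ (transpose_mul_mul_nonneg hR.posSemidef.nonneg L)
  · convert hK using 1
    rw [Matrix.mul_sub]
    abel

-- Multiplied by `P⁻¹` from both sides, the Riccati equation becomes a Lyapunov equation for the
-- transposed closed loop, and the transpose of `F + G K` witnesses detectability through `Gᵀ`.
lemma isHurwitz_add_mul_riccatiGain_of_riccatiResidual_eq_zero (hQ : 0 ≤ Q) (hR : R.PosDef)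
    (hK : IsHurwitz (F + G * K)) (hP_pos : P.PosDef) (hP : riccatiResidual F G Q R P = 0) :
    IsHurwitz (F + G * riccatiGain G R P) := by
  set L := riccatiGain G R P with hL
  have hP_unit : IsUnit P.det := (isUnit_iff_isUnit_det P).1 hP_pos.isUnit
  refine IsHurwitz.of_transpose (isHurwitz_of_lyapunov_of_detectable (P := P⁻¹) (C := Gᵀ)
    (R := R⁻¹) (H := (K - L)ᵀ) hP_pos.inv.posSemidef.nonneg hR.inv ?_ ?_)
  · have hsum : P⁻¹ * (F + G * L)ᵀ + (F + G * L)ᵀᵀ * P⁻¹ + Gᵀᵀ * R⁻¹ * Gᵀ =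
        -(P⁻¹ᵀ * Q * P⁻¹) := by
      have hconj : P⁻¹ * riccatiResidual F G Q R P * P⁻¹ = 0 := by
        rw [hP, Matrix.mul_zero, Matrix.zero_mul]
      rw [← sub_eq_zero, ← hconj]
      simp only [riccatiResidual, hL, riccatiGain, transpose_add, transpose_mul, transpose_neg,
        transpose_transpose, transpose_eq_of_nonneg hP_pos.posSemidef.nonneg,
        transpose_eq_of_nonneg hP_pos.inv.posSemidef.nonneg,
        transpose_eq_of_nonneg hR.inv.posSemidef.nonneg, Matrix.mul_add, Matrix.add_mul,
        Matrix.mul_sub, Matrix.sub_mul, Matrix.mul_neg, Matrix.neg_mul, Matrix.mul_assoc,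
        Matrix.nonsing_inv_mul_cancel_left _ _ hP_unit, Matrix.mul_nonsing_inv _ hP_unit,
        Matrix.mul_one]
      abel
    rw [hsum, neg_nonpos]
    exact transpose_mul_mul_nonneg hQ P⁻¹
  · convert hK.transpose using 1
    rw [← transpose_mul, ← transpose_add, Matrix.mul_sub]
    congr 1
    abel

lemma eq_of_riccatiResidual_eq_zero (hQ : 0 ≤ Q) (hR : R.PosDef) (hK : IsHurwitz (F + G * K))
    (hP_pos : P.PosDef) (hP : riccatiResidual F G Q R P = 0)
    (hP'_pos : P'.PosDef) (hP' : riccatiResidual F G Q R P' = 0) : P = P' := by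
  have key : ∀ {P P' : Matrix (Fin n) (Fin n) ℝ}, P.PosDef → riccatiResidual F G Q R P = 0 →
      P'.PosDef → riccatiResidual F G Q R P' = 0 → P' ≤ P := by
    intro P P' hP_pos hP hP'_pos hP'
    exact le_of_riccatiResidual_nonneg hR
      (isHurwitz_add_mul_riccatiGain_of_riccatiResidual_eq_zero hQ hR hK hP_pos hP)
      ((lyapunovResidual_riccatiGain hR hP_pos.posSemidef.nonneg).trans hP)
      hP'_pos.posSemidef.nonneg hP'.ge
  exact le_antisymm (key hP'_pos hP' hP_pos hP) (key hP_pos hP hP'_pos hP')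

end Riccati

section LoewnerLimits

variable {ι : Type*}

instance orderClosedTopology_matrix [Finite ι] : OrderClosedTopology (Matrix ι ι ℝ) where
  isClosed_le' := by
    have := Fintype.ofFinite ι
    have hset : {p : Matrix ι ι ℝ × Matrix ι ι ℝ | p.1 ≤ p.2} =
        {p | (p.2 - p.1)ᴴ = p.2 - p.1} ∩ ⋂ x : ι → ℝ, {p | 0 ≤ star x ⬝ᵥ (p.2 - p.1) *ᵥ x} := by
      ext p
      simp only [le_iff, posSemidef_iff_dotProduct_mulVec, IsHermitian, Set.mem_inter_iff,
        Set.mem_iInter, Set.mem_ofPred_eq]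
    rw [hset]
    exact (isClosed_eq (by fun_prop) (by fun_prop)).inter
      (isClosed_iInter fun x => isClosed_le (by fun_prop) (by fun_prop))

lemma dotProduct_mulVec_mono [Fintype ι] {M N : Matrix ι ι ℝ} (h : M ≤ N) (x : ι → ℝ) :
    x ⬝ᵥ M *ᵥ x ≤ x ⬝ᵥ N *ᵥ x := by
  have := (le_iff.1 h).dotProduct_mulVec_nonneg x
  rwa [sub_mulVec, dotProduct_sub, star_trivial, sub_nonneg] at this

lemma apply_eq_polarization [Fintype ι] [DecidableEq ι] {M : Matrix ι ι ℝ} (hM : Mᵀ = M) (i j : ι) :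
    M i j = ((Pi.single i 1 + Pi.single j 1) ⬝ᵥ M *ᵥ (Pi.single i 1 + Pi.single j 1) -
      Pi.single i 1 ⬝ᵥ M *ᵥ Pi.single i 1 - Pi.single j 1 ⬝ᵥ M *ᵥ Pi.single j 1) / 2 := by
  have hji : M j i = M i j := congrFun₂ hM i j
  simp only [mulVec_add, mulVec_single_one, dotProduct_add, add_dotProduct,
    single_one_dotProduct, col_apply, hji]
  ring

lemma exists_tendsto_of_antitone_of_nonneg [Finite ι] {P : ℕ → Matrix ι ι ℝ}
    (hP : Antitone P) (hP_nonneg : ∀ k, 0 ≤ P k) : ∃ L, Tendsto P atTop (𝓝 L) := by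
  classical
  have := Fintype.ofFinite ι
  have hform : ∀ x : ι → ℝ, ∃ l, Tendsto (fun k => x ⬝ᵥ P k *ᵥ x) atTop (𝓝 l) := fun x =>
    ⟨_, tendsto_atTop_ciInf (fun i j hij => dotProduct_mulVec_mono (hP hij) x)
      ⟨0, by rintro _ ⟨k, rfl⟩; simpa using dotProduct_mulVec_mono (hP_nonneg k) x⟩⟩
  choose q hq using hform
  refine ⟨of fun i j => (q (Pi.single i 1 + Pi.single j 1) - q (Pi.single i 1) -
    q (Pi.single j 1)) / 2, tendsto_pi_nhds.2 fun i => tendsto_pi_nhds.2 fun j => ?_⟩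
  simp only [fun k => apply_eq_polarization (transpose_eq_of_nonneg (hP_nonneg k)) i j]
  exact (((hq _).sub (hq _)).sub (hq _)).div_const 2

end LoewnerLimits

section KleinmanIteration

variable {n : ℕ} {κ : Type*} [Fintype κ] [DecidableEq κ]

/-- `(P i, K i)`, `i = 0, 1, …`, is a run of Kleinman's iteration (policy iteration, or Newton's
method for the Riccati equation) for the state feedback `u = K x` on `ẋ = F x + G u`. The initial
gain `K 0` is arbitrary. -/
structure IsKleinmanIteration (F : Matrix (Fin n) (Fin n) ℝ) (G : Matrix (Fin n) κ ℝ)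
    (Q : Matrix (Fin n) (Fin n) ℝ) (R : Matrix κ κ ℝ) (P : ℕ → Matrix (Fin n) (Fin n) ℝ)
    (K : ℕ → Matrix κ (Fin n) ℝ) : Prop where
  evaluation : ∀ i, lyapunovResidual F G Q R (K i) (P i) = 0
  improvement : ∀ i, K (i + 1) = riccatiGain G R (P i)

variable {F Q L : Matrix (Fin n) (Fin n) ℝ} {G : Matrix (Fin n) κ ℝ} {R : Matrix κ κ ℝ}
  {P : ℕ → Matrix (Fin n) (Fin n) ℝ} {K : ℕ → Matrix κ (Fin n) ℝ}

lemma exists_isKleinmanIteration (hQ : 0 ≤ Q) (hR : R.PosDef) {K₀ : Matrix κ (Fin n) ℝ}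
    (hK₀ : IsHurwitz (F + G * K₀)) :
    ∃ P K, K 0 = K₀ ∧ IsKleinmanIteration F G Q R P K := by
  choose! cost hcost using fun (K : Matrix κ (Fin n) ℝ) (hK : IsHurwitz (F + G * K)) =>
    exists_lyapunovResidual_eq_zero (Q := Q) (R := R) hK
  let K : ℕ → Matrix κ (Fin n) ℝ := fun i => (fun K => riccatiGain G R (cost K))^[i] K₀
  have hK_succ : ∀ i, K (i + 1) = riccatiGain G R (cost (K i)) := fun i =>
    Function.iterate_succ_apply' _ i K₀
  have hK : ∀ i, IsHurwitz (F + G * K i) := by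
    intro i
    induction i with
    | zero => exact hK₀
    | succ i ih =>
      rw [hK_succ]
      exact isHurwitz_add_mul_riccatiGain_of_lyapunovResidual_eq_zero hQ hR ih (hcost _ ih)
  exact ⟨fun i => cost (K i), K, rfl, fun i => hcost _ (hK i), hK_succ⟩

lemma continuous_riccatiGain : Continuous (riccatiGain G R) := by
  unfold riccatiGain
  fun_prop

namespace IsKleinmanIteration

variable (h : IsKleinmanIteration F G Q R P K)
include h

lemma tendsto_gain (hL : Tendsto P atTop (𝓝 L)) : Tendsto K atTop (𝓝 (riccatiGain G R L)) := by
  rw [← tendsto_add_atTop_iff_nat 1]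
  exact ((continuous_riccatiGain.tendsto L).comp hL).congr fun i => (h.improvement i).symm

lemma riccatiResidual_eq_zero_of_tendsto (hR : R.PosDef) (hL_nonneg : 0 ≤ L)
    (hL : Tendsto P atTop (𝓝 L)) : riccatiResidual F G Q R L = 0 := by
  rw [← lyapunovResidual_riccatiGain hR hL_nonneg]
  have hlim := (continuous_lyapunovResidual (F := F) (G := G) (Q := Q) (R := R)).tendsto
    (riccatiGain G R L, L) |>.comp ((h.tendsto_gain hL).prodMk_nhds hL)
  exact tendsto_nhds_unique (hlim.congr h.evaluation) tendsto_const_nhds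

variable (hQ : 0 ≤ Q) (hR : R.PosDef) (hK₀ : IsHurwitz (F + G * K 0))
include hQ hR hK₀

lemma isHurwitz (i : ℕ) : IsHurwitz (F + G * K i) := by
  induction i with
  | zero => exact hK₀
  | succ i ih =>
    rw [h.improvement]
    exact isHurwitz_add_mul_riccatiGain_of_lyapunovResidual_eq_zero hQ hR ih (h.evaluation i)

lemma nonneg (i : ℕ) : 0 ≤ P i :=
  nonneg_of_lyapunovResidual_eq_zero hQ hR (h.isHurwitz hQ hR hK₀ i) (h.evaluation i)

lemma antitone : Antitone P := by
  refine antitone_nat_of_succ_le fun i => ?_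
  have hK := h.isHurwitz hQ hR hK₀ (i + 1)
  have hP := h.evaluation (i + 1)
  rw [h.improvement] at hK hP
  exact le_of_policy_improvement hR (h.nonneg hQ hR hK₀ i) hK (h.evaluation i) hP

lemma le_of_riccatiResidual_eq_zero (hL_nonneg : 0 ≤ L) (hL : riccatiResidual F G Q R L = 0)
    (i : ℕ) : L ≤ P i :=
  le_of_riccatiResidual_nonneg hR (h.isHurwitz hQ hR hK₀ i) (h.evaluation i) hL_nonneg hL.ge

lemma exists_tendsto :
    ∃ L, 0 ≤ L ∧ riccatiResidual F G Q R L = 0 ∧ Tendsto P atTop (𝓝 L) := by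
  have hP_nonneg := h.nonneg hQ hR hK₀
  obtain ⟨L, hL⟩ := exists_tendsto_of_antitone_of_nonneg (h.antitone hQ hR hK₀) hP_nonneg
  have hL_nonneg : 0 ≤ L := ge_of_tendsto' hL hP_nonneg
  exact ⟨L, hL_nonneg, h.riccatiResidual_eq_zero_of_tendsto hR hL_nonneg hL, hL⟩

lemma posDef (hL_pos : L.PosDef) (hL : riccatiResidual F G Q R L = 0) (i : ℕ) :
    (P i).PosDef :=
  posDef_of_le hL_pos
    (h.le_of_riccatiResidual_eq_zero hQ hR hK₀ hL_pos.posSemidef.nonneg hL i)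

lemma tendsto (hL_pos : L.PosDef) (hL : riccatiResidual F G Q R L = 0) :
    Tendsto P atTop (𝓝 L) := by
  obtain ⟨L', -, hL', hlim⟩ := h.exists_tendsto hQ hR hK₀
  have hle : L ≤ L' := ge_of_tendsto' hlim
    (h.le_of_riccatiResidual_eq_zero hQ hR hK₀ hL_pos.posSemidef.nonneg hL)
  rwa [eq_of_riccatiResidual_eq_zero hQ hR hK₀ hL_pos hL (posDef_of_le hL_pos hle) hL']

end IsKleinmanIteration

end KleinmanIteration

section Observability

variable {n : ℕ} {κ : Type*} [Fintype κ] [DecidableEq κ] {A C F P S : Matrix (Fin n) (Fin n) ℝ}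
  {G : Matrix (Fin n) κ ℝ} {R : Matrix κ κ ℝ} {v : Fin n → ℝ}

lemma IsObservable.eq_zero (h : IsObservable C A) (hv : ∀ k : ℕ, C *ᵥ (A ^ k *ᵥ v) = 0) :
    v = 0 := by
  have hcols : LinearIndependent ℝ (observabilityMatrix C A).col := by
    rw [linearIndependent_iff_card_eq_finrank_span, Fintype.card_fin]
    exact h.symm.trans (rank_eq_finrank_span_cols _)
  refine mulVec_injective_iff.2 hcols ?_
  rw [mulVec_zero]
  ext ⟨k, j⟩
  have := congrFun (hv k) j
  rwa [mulVec_mulVec] at this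

lemma mulVec_mem_of_forall_inv_mulVec_mem (hA : IsUnit A.det) {W : Submodule ℝ (Fin n → ℝ)}
    (hW : ∀ w ∈ W, A⁻¹ *ᵥ w ∈ W) (hv : v ∈ W) : A *ᵥ v ∈ W := by
  have hinj : Function.Injective A⁻¹.mulVecLin :=
    mulVec_injective_iff_isUnit.2 ((isUnit_iff_isUnit_det _).2 (isUnit_nonsing_inv_det A hA))
  have hmap : W.map A⁻¹.mulVecLin = W :=
    Submodule.eq_of_le_of_finrank_eq (Submodule.map_le_iff_le_comap.2 hW)
      (LinearEquiv.finrank_eq (Submodule.equivMapOfInjective _ hinj W)).symm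
  obtain ⟨w, hw, rfl⟩ := hmap.symm ▸ hv
  simpa [mulVec_mulVec, mul_nonsing_inv _ hA] using hw

lemma mulVec_eq_zero_of_riccatiResidual_eq_zero (hP : 0 ≤ P)
    (h : riccatiResidual F G (Sᵀ * S) R P = 0) (hv : P *ᵥ v = 0) :
    S *ᵥ v = 0 ∧ P *ᵥ (F *ᵥ v) = 0 := by
  have hvP : v ᵥ* P = 0 := by rw [← mulVec_transpose, transpose_eq_of_nonneg hP, hv]
  have hsum : P *ᵥ (F *ᵥ v) + Sᵀ *ᵥ (S *ᵥ v) = 0 := by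
    have := congrArg (· *ᵥ v) h
    simpa only [riccatiResidual, add_mulVec, sub_mulVec, zero_mulVec, ← mulVec_mulVec, hv,
      mulVec_zero, add_zero, sub_zero] using this
  have hS : S *ᵥ v = 0 := by
    have := congrArg (v ⬝ᵥ ·) hsum
    rw [← dotProduct_self_eq_zero]
    simpa only [dotProduct_add, dotProduct_mulVec, hvP, zero_dotProduct, zero_add,
      vecMul_transpose, dotProduct_zero, zero_vecMul] using this
  exact ⟨hS, by simpa only [hS, mulVec_zero, add_zero] using hsum⟩

lemma posDef_of_riccatiResidual_eq_zero_of_isObservable (hA : IsUnit A.det)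
    (hobs : IsObservable S A) (hP : 0 ≤ P) (h : riccatiResidual A⁻¹ G (Sᵀ * S) R P = 0) :
    P.PosDef := by
  have hker : ∀ {v}, P *ᵥ v = 0 → S *ᵥ v = 0 ∧ P *ᵥ (A⁻¹ *ᵥ v) = 0 :=
    mulVec_eq_zero_of_riccatiResidual_eq_zero hP h
  rw [(nonneg_iff_posSemidef.1 hP).posDef_iff_det_ne_zero]
  intro hdet
  obtain ⟨v, hv0, hv⟩ := exists_mulVec_eq_zero_iff.2 hdet
  have hpow : ∀ k : ℕ, P *ᵥ (A ^ k *ᵥ v) = 0 := by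
    intro k
    induction k with
    | zero => simpa using hv
    | succ k ih =>
      rw [pow_succ', ← mulVec_mulVec]
      exact mulVec_mem_of_forall_inv_mulVec_mem (W := LinearMap.ker P.mulVecLin) hA
        (fun w hw => (hker hw).2) ih
  exact hv0 (hobs.eq_zero fun k => (hker (hpow k)).1)

end Observability

section DerivativeFeedback

variable {n m : ℕ} {A Q P P' S : Matrix (Fin n) (Fin n) ℝ} {B : Matrix (Fin n) (Fin m) ℝ}
  {R : Matrix (Fin m) (Fin m) ℝ} {K K₁ : Matrix (Fin m) (Fin n) ℝ}

lemma closedLoopInv_eq : closedLoopInv A B K = A⁻¹ + A⁻¹ * B * K := by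
  rw [closedLoopInv, Matrix.mul_add, Matrix.mul_one, Matrix.mul_assoc]

lemma isStabilizing_iff_isHurwitz_add :
    IsStabilizing A B K ↔ IsHurwitz (A⁻¹ + A⁻¹ * B * K) := by
  rw [isStabilizing_iff, closedLoopInv_eq]

lemma gain_eq_riccatiGain : gain A B R P = riccatiGain (A⁻¹ * B) R P := by
  rw [gain, riccatiGain, transpose_mul, Matrix.mul_assoc R⁻¹]

lemma solvesARE_iff : SolvesARE A B Q R P ↔ riccatiResidual A⁻¹ (A⁻¹ * B) Q R P = 0 := by
  simp only [SolvesARE, riccatiResidual, transpose_mul, Matrix.mul_assoc]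

lemma solvesLyapunov_iff :
    SolvesLyapunov A B Q R K P ↔ lyapunovResidual A⁻¹ (A⁻¹ * B) Q R K P = 0 := by
  rw [SolvesLyapunov, closedLoopInv_eq, lyapunovResidual]

lemma isPolicyIteration_iff {P : ℕ → Matrix (Fin n) (Fin n) ℝ}
    {K : ℕ → Matrix (Fin m) (Fin n) ℝ} :
    IsPolicyIteration A B Q R K₁ P K ↔ K 1 = K₁ ∧ (∀ i, (P (i + 1)).PosDef) ∧
      IsKleinmanIteration A⁻¹ (A⁻¹ * B) Q R (fun i => P (i + 1)) (fun i => K (i + 1)) := by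
  refine ⟨fun h => ⟨h.init, fun i => h.posDef _ i.succ_pos,
    fun i => solvesLyapunov_iff.1 (h.evaluation _ i.succ_pos),
    fun i => gain_eq_riccatiGain ▸ h.improvement _ i.succ_pos⟩,
    fun ⟨hinit, hpos, h⟩ => ⟨hinit, fun i hi => ?_, fun i hi => ?_, fun i hi => ?_⟩⟩ <;>
    obtain ⟨j, rfl⟩ := Nat.exists_eq_add_of_le' hi
  · exact hpos j
  · exact solvesLyapunov_iff.2 (h.evaluation j)
  · exact gain_eq_riccatiGain ▸ h.improvement j

lemma eq_of_solvesARE (hQ : 0 ≤ Q) (hR : R.PosDef) (hK₁ : IsStabilizing A B K₁)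
    (hP_pos : P.PosDef) (hP : SolvesARE A B Q R P) (hP'_pos : P'.PosDef)
    (hP' : SolvesARE A B Q R P') : P = P' :=
  eq_of_riccatiResidual_eq_zero hQ hR (isStabilizing_iff_isHurwitz_add.1 hK₁) hP_pos
    (solvesARE_iff.1 hP) hP'_pos (solvesARE_iff.1 hP')

lemma exists_posDef_solvesARE (hR : R.PosDef) (hK₁ : IsStabilizing A B K₁) (hSQ : Sᵀ * S = Q)
    (hS : IsObservable S A) : ∃ P, P.PosDef ∧ SolvesARE A B Q R P := by
  have hQ : 0 ≤ Q := hSQ ▸ by simpa using (posSemidef_conjTranspose_mul_self S).nonneg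
  have hHurwitz := isStabilizing_iff_isHurwitz_add.1 hK₁
  obtain ⟨P, K, rfl, h⟩ := exists_isKleinmanIteration hQ hR hHurwitz
  obtain ⟨L, hL_nonneg, hL, -⟩ := h.exists_tendsto hQ hR hHurwitz
  subst hSQ
  exact ⟨L, posDef_of_riccatiResidual_eq_zero_of_isObservable hK₁.isUnit_det hS hL_nonneg hL,
    solvesARE_iff.2 hL⟩

lemma exists_isPolicyIteration (hQ : 0 ≤ Q) (hR : R.PosDef) (hK₁ : IsStabilizing A B K₁)
    (hP_pos : P.PosDef) (hP : SolvesARE A B Q R P) :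
    ∃ P K, IsPolicyIteration A B Q R K₁ P K := by
  have hHurwitz := isStabilizing_iff_isHurwitz_add.1 hK₁
  obtain ⟨P', K', rfl, h⟩ := exists_isKleinmanIteration hQ hR hHurwitz
  exact ⟨fun i => P' (i - 1), fun i => K' (i - 1), isPolicyIteration_iff.2
    ⟨rfl, h.posDef hQ hR hHurwitz hP_pos (solvesARE_iff.1 hP), h⟩⟩

namespace IsPolicyIteration

variable {P : ℕ → Matrix (Fin n) (Fin n) ℝ} {K : ℕ → Matrix (Fin m) (Fin n) ℝ}
  {L : Matrix (Fin n) (Fin n) ℝ} {i : ℕ}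

lemma isKleinmanIteration (h : IsPolicyIteration A B Q R K₁ P K) :
    IsKleinmanIteration A⁻¹ (A⁻¹ * B) Q R (fun i => P (i + 1)) (fun i => K (i + 1)) :=
  (isPolicyIteration_iff.1 h).2.2

lemma isHurwitz_init (h : IsPolicyIteration A B Q R K₁ P K) (hK₁ : IsStabilizing A B K₁) :
    IsHurwitz (A⁻¹ + A⁻¹ * B * K 1) :=
  isStabilizing_iff_isHurwitz_add.1 (h.init.symm ▸ hK₁)

variable (h : IsPolicyIteration A B Q R K₁ P K) (hQ : 0 ≤ Q) (hR : R.PosDef)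
  (hK₁ : IsStabilizing A B K₁)
include h hQ hR hK₁

lemma isStabilizing (hi : 1 ≤ i) : IsStabilizing A B (K i) := by
  obtain ⟨j, rfl⟩ := Nat.exists_eq_add_of_le' hi
  exact isStabilizing_iff_isHurwitz_add.2
    (h.isKleinmanIteration.isHurwitz hQ hR (h.isHurwitz_init hK₁) j)

lemma eq_of_solvesLyapunov (hi : 1 ≤ i) (hL : SolvesLyapunov A B Q R (K i) L) : L = P i :=
  eq_of_lyapunovResidual_eq (isStabilizing_iff_isHurwitz_add.1 (h.isStabilizing hQ hR hK₁ hi))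
    ((solvesLyapunov_iff.1 hL).trans (solvesLyapunov_iff.1 (h.evaluation i hi)).symm)

lemma succ_le (hi : 1 ≤ i) : P (i + 1) ≤ P i := by
  obtain ⟨j, rfl⟩ := Nat.exists_eq_add_of_le' hi
  exact h.isKleinmanIteration.antitone hQ hR (h.isHurwitz_init hK₁) j.le_succ

variable (hL_pos : L.PosDef) (hL : SolvesARE A B Q R L)
include hL_pos hL

lemma le_of_solvesARE (hi : 1 ≤ i) : L ≤ P i := by
  obtain ⟨j, rfl⟩ := Nat.exists_eq_add_of_le' hi
  exact h.isKleinmanIteration.le_of_riccatiResidual_eq_zero hQ hR (h.isHurwitz_init hK₁)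
    hL_pos.posSemidef.nonneg (solvesARE_iff.1 hL) j

lemma tendsto : Tendsto P atTop (𝓝 L) :=
  (tendsto_add_atTop_iff_nat 1).1
    (h.isKleinmanIteration.tendsto hQ hR (h.isHurwitz_init hK₁) hL_pos (solvesARE_iff.1 hL))

lemma tendsto_gain : Tendsto K atTop (𝓝 (gain A B R L)) := by
  rw [← tendsto_add_atTop_iff_nat 1, gain_eq_riccatiGain]
  exact h.isKleinmanIteration.tendsto_gain
    ((tendsto_add_atTop_iff_nat 1).2 (h.tendsto hQ hR hK₁ hL_pos hL))

end IsPolicyIteration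

end DerivativeFeedback

end DFC

theorem theorem1_general {n m : ℕ}
    (A : Matrix (Fin n) (Fin n) ℝ) (B : Matrix (Fin n) (Fin m) ℝ)
    (Q : Matrix (Fin n) (Fin n) ℝ) (R : Matrix (Fin m) (Fin m) ℝ)
    (hQ : Q.PosSemidef) (hR : R.PosDef)
    (K₁ : Matrix (Fin m) (Fin n) ℝ) (hK₁ : DFC.IsStabilizing A B K₁) :
    (∀ S : Matrix (Fin n) (Fin n) ℝ, Sᵀ * S = Q → DFC.IsObservable S A →
      ∃ Pstar : Matrix (Fin n) (Fin n) ℝ, Pstar.PosDef ∧ DFC.SolvesARE A B Q R Pstar) ∧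
    ∀ Pstar : Matrix (Fin n) (Fin n) ℝ, Pstar.PosDef → DFC.SolvesARE A B Q R Pstar →
      (∀ P' : Matrix (Fin n) (Fin n) ℝ, P'.PosDef → DFC.SolvesARE A B Q R P' → P' = Pstar) ∧
      (∃ (P : ℕ → Matrix (Fin n) (Fin n) ℝ) (K : ℕ → Matrix (Fin m) (Fin n) ℝ),
        DFC.IsPolicyIteration A B Q R K₁ P K) ∧
      ∀ (P : ℕ → Matrix (Fin n) (Fin n) ℝ) (K : ℕ → Matrix (Fin m) (Fin n) ℝ),
        DFC.IsPolicyIteration A B Q R K₁ P K →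
        (∀ i, 1 ≤ i → ∀ P' : Matrix (Fin n) (Fin n) ℝ, P'.PosDef →
          DFC.SolvesLyapunov A B Q R (K i) P' → P' = P i) ∧
        (∀ i, 1 ≤ i → DFC.IsStabilizing A B (K (i + 1))) ∧
        (∀ i, 1 ≤ i → (P (i + 1) - Pstar).PosSemidef ∧ (P i - P (i + 1)).PosSemidef) ∧
        Tendsto P atTop (𝓝 Pstar) ∧
        Tendsto K atTop (𝓝 (DFC.gain A B R Pstar)) := by
  have hQ_nonneg := hQ.nonneg
  refine ⟨fun _ hS hSA => DFC.exists_posDef_solvesARE hR hK₁ hS hSA, fun _ hpos hare =>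
    ⟨fun _ hpos' hare' => DFC.eq_of_solvesARE hQ_nonneg hR hK₁ hpos' hare' hpos hare,
      DFC.exists_isPolicyIteration hQ_nonneg hR hK₁ hpos hare, fun _ _ h => ⟨?_, ?_, ?_, ?_, ?_⟩⟩⟩
  · exact fun _ hi _ _ hP' => h.eq_of_solvesLyapunov hQ_nonneg hR hK₁ hi hP'
  · exact fun i _ => h.isStabilizing hQ_nonneg hR hK₁ i.succ_pos
  · exact fun i hi => ⟨h.le_of_solvesARE hQ_nonneg hR hK₁ hpos hare i.succ_pos,
      h.succ_le hQ_nonneg hR hK₁ hi⟩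
  · exact h.tendsto hQ_nonneg hR hK₁ hpos hare
  · exact h.tendsto_gain hQ_nonneg hR hK₁ hpos hare

theorem theorem1 {n m : ℕ}
    (A : Matrix (Fin n) (Fin n) ℝ) (B : Matrix (Fin n) (Fin m) ℝ)
    (Q : Matrix (Fin n) (Fin n) ℝ) (R : Matrix (Fin m) (Fin m) ℝ)
    (hA : A.rank = n) (hAB : DFC.IsControllable A B)
    (hQ : Q.PosSemidef) (hR : R.PosDef)
    (K₁ : Matrix (Fin m) (Fin n) ℝ) (hK₁ : DFC.IsStabilizing A B K₁) :
    -- if `(Q^{1/2}, A)` is observable, the Riccati equation has a positive definite solution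
    (∀ S : Matrix (Fin n) (Fin n) ℝ, S.PosSemidef → S * S = Q → DFC.IsObservable S A →
      ∃ Pstar : Matrix (Fin n) (Fin n) ℝ, Pstar.PosDef ∧ DFC.SolvesARE A B Q R Pstar) ∧
    -- whenever there is one, it is unique and policy iteration is well defined and converges to it
    ∀ Pstar : Matrix (Fin n) (Fin n) ℝ, Pstar.PosDef → DFC.SolvesARE A B Q R Pstar →
      (∀ P' : Matrix (Fin n) (Fin n) ℝ, P'.PosDef → DFC.SolvesARE A B Q R P' → P' = Pstar) ∧
      (∃ (P : ℕ → Matrix (Fin n) (Fin n) ℝ) (K : ℕ → Matrix (Fin m) (Fin n) ℝ),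
        DFC.IsPolicyIteration A B Q R K₁ P K) ∧
      ∀ (P : ℕ → Matrix (Fin n) (Fin n) ℝ) (K : ℕ → Matrix (Fin m) (Fin n) ℝ),
        DFC.IsPolicyIteration A B Q R K₁ P K →
        (∀ i, 1 ≤ i → ∀ P' : Matrix (Fin n) (Fin n) ℝ, P'.PosDef →
          DFC.SolvesLyapunov A B Q R (K i) P' → P' = P i) ∧
        (∀ i, 1 ≤ i → IsUnit (1 + B * K (i + 1)).det ∧
          DFC.IsHurwitz ((1 + B * K (i + 1))⁻¹ * A)) ∧
        (∀ i, 1 ≤ i → (P (i + 1) - Pstar).PosSemidef ∧ (P i - P (i + 1)).PosSemidef) ∧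
        Tendsto P atTop (𝓝 Pstar) ∧
        Tendsto K atTop (𝓝 (DFC.gain A B R Pstar)) := by
  obtain ⟨h, h'⟩ := theorem1_general A B Q R hQ hR K₁ hK₁
  exact ⟨fun S hS hSQ => h S (by rwa [← conjTranspose_eq_transpose_of_trivial, hS.isHermitian]), h'⟩
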